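/- Let $T$ be an arbitrary first-order theory. Sets of parameters and all tuples below live in models of $T$ and their elementary extensions (equivalently, in a monster model when $T$ is complete). All sequences are indexed by $\omega$ and consist of finite tuples, the length of the tuples being fixed within each sequence. Sequences $(I^j)_{j}$ are mutually indiscernible over $A$ if each $I^j$ is indiscernible over $A\cup\bigcup_{i\ne j}I^i$. For a (partial, consistent) type $p(x)$ in finitely many variables over a set $A$ and a cardinal $\mu$, the dp-rank of $p$ is at most $\mu$, $\mathrm{rk}_{dp}(p)\le\mu$, if for every realization $a$ of $p$ and every family of $1+\mu$ sequences mutually indiscernible over $A$, at least one of the sequences is indiscernible over $A\cup a$. The type $p$ is dependent if $\mathrm{rk}_{dp}(p)\le\mu$ for some cardinal $\mu$, and strongly dependent if $\mathrm{rk}_{dp}(p)\le\omega$. The theory $T$ is strongly dependent if every type in finitely many variables, over any set, is strongly dependent. The theory $T$ is dependent if no formula $\varphi(x,y)$ ($x,y$ finite tuples of variables) has the independence property, where $\varphi(x,y)$ has the independence property if in some model of $T$ there are, for every $r<\omega$, tuples $b_0,\dots,b_{r-1}$ such that for every $S\subseteq\{0,\dots,r-1\}$ there is a tuple $a$ with $\varphi(a,b_i)\iff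 i\in S$ for all $i<r$. Then: 1. $T$ is strongly dependent if and only if all types in one variable, over any set, are strongly dependent. 2. $T$ is dependent if and only if every type in finitely many variables, over any set, is dependent. 3. $T$ is dependent if and only if all types in one variable, over any set, are dependent. 4. (Shelah) $T$ is dependent if and only if no formula $\varphi(x,y)$ with $x$ a single variable (and $y$ an arbitrary finite tuple) has the independence property. -/

import Mathlib

universe u v

namespace DpRank

open FirstOrder FirstOrder.Language Cardinal

/-- The set of elements that occur in a sequence of `m`-tuples. -/
def seqSet {N : Type*} {m : ℕ} (I : ℕ → Fin m → N) : Set N :=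
  Set.range fun q : ℕ × Fin m => I q.1 q.2

/-- The sequence `I` of `m`-tuples of `N` is indiscernible over `B ⊆ N`: any two strictly
increasing `k`-tuples of indices give tuples of `N` that satisfy the same formulas with parameters
in `B`. A formula with parameters in `B` is a formula whose free variables are indexed by
`B ⊕ γ`, the variables from `B` being interpreted by themselves. -/
def IsIndiscernible (L : FirstOrder.Language.{u, v}) {N : Type*} [L.Structure N] (B : Set N) {m : ℕ}
    (I : ℕ → Fin m → N) : Prop :=
  ∀ (k : ℕ) (φ : L.Formula (B ⊕ (Fin k × Fin m))) (s t : Fin k → ℕ),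
    StrictMono s → StrictMono t →
      (φ.Realize (Sum.elim (fun b : B => (b : N)) fun q => I (s q.1) q.2) ↔
        φ.Realize (Sum.elim (fun b : B => (b : N)) fun q => I (t q.1) q.2))

/-- The sequences `I j` (the `j`-th one consisting of `m j`-tuples) are mutually indiscernible
over `B`: each of them is indiscernible over `B` together with all the other sequences. -/
def MutuallyIndiscernible (L : FirstOrder.Language.{u, v}) {N : Type*} [L.Structure N] (B : Set N)
    {ι : Type*} {m : ι → ℕ} (I : ∀ j, ℕ → Fin (m j) → N) : Prop :=
  ∀ j, IsIndiscernible L (B ∪ ⋃ i ∈ {i | i ≠ j}, seqSet (I i)) (I j)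

section Types

variable {L : FirstOrder.Language.{u, v}} {M : Type (max u v)} [L.Structure M] {A : Set M} {n : ℕ}

/-- `p`, a set of formulas in `n` variables with parameters in `A ⊆ M`, is a (partial) type over
`A`: it is consistent with the elementary diagram of `M`, i.e. finitely satisfiable in `M`. -/
def IsPartialType (p : Set (L.Formula (A ⊕ Fin n))) : Prop :=
  ∀ p₀ ⊆ p, p₀.Finite →
    ∃ a : Fin n → M, ∀ φ ∈ p₀, φ.Realize (Sum.elim (fun b : A => (b : M)) a)

/-- The tuple `a` of the elementary extension `f : M ↪ₑ[L] N` realizes `p`. -/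
def Realizes (p : Set (L.Formula (A ⊕ Fin n))) {N : Type (max u v)} [L.Structure N]
    (f : M ↪ₑ[L] N) (a : Fin n → N) : Prop :=
  ∀ φ ∈ p, φ.Realize (Sum.elim (fun b : A => f b) a)

/-- The dp-rank of the type `p` over `A` is at most `μ`: for every realization `a` of `p` and every
family of `1 + μ` sequences which are mutually indiscernible over `A`, one of the sequences is
indiscernible over `A ∪ a`. The realization and the sequences live in an arbitrary elementary
extension of `M`, which takes the place of the monster model. -/
def DpRankLE (p : Set (L.Formula (A ⊕ Fin n))) (μ : Cardinal.{max u v}) : Prop :=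
  ∀ (N : Type (max u v)) [L.Structure N] (f : M ↪ₑ[L] N) (a : Fin n → N), Realizes p f a →
    ∀ (ι : Type (max u v)), #ι = 1 + μ →
      ∀ (m : ι → ℕ) (I : ∀ j, ℕ → Fin (m j) → N), MutuallyIndiscernible L (f '' A) I →
        ∃ j, IsIndiscernible L (f '' A ∪ Set.range a) (I j)

/-- The type `p` is dependent: its dp-rank exists. -/
def DependentType (p : Set (L.Formula (A ⊕ Fin n))) : Prop :=
  ∃ μ : Cardinal.{max u v}, DpRankLE p μ

/-- The type `p` is strongly dependent: its dp-rank is at most `ω`. -/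
def StronglyDependentType (p : Set (L.Formula (A ⊕ Fin n))) : Prop :=
  DpRankLE p ℵ₀

end Types

section Theories

variable {L : FirstOrder.Language.{u, v}} (T : L.Theory)

/-- All the types in `n` variables in `T`, over arbitrary sets of parameters in models of `T`, are
dependent. -/
def AllTypesDependent (n : ℕ) : Prop :=
  ∀ (M : Theory.ModelType.{u, v, max u v} T) (A : Set M) (p : Set (L.Formula (A ⊕ Fin n))),
    IsPartialType p → DependentType p

/-- All the types in `n` variables in `T`, over arbitrary sets of parameters in models of `T`, are
strongly dependent. -/
def AllTypesStronglyDependent (n : ℕ) : Prop :=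
  ∀ (M : Theory.ModelType.{u, v, max u v} T) (A : Set M) (p : Set (L.Formula (A ⊕ Fin n))),
    IsPartialType p → StronglyDependentType p

/-- `T` is strongly dependent: every type in finitely many variables is. -/
def StronglyDependentTheory : Prop :=
  ∀ n, AllTypesStronglyDependent T n

/-- The formula `φ(x; y)`, with `x` an `n`-tuple and `y` a `k`-tuple of variables, has the
independence property in `T`: some model of `T` contains, for every `r`, tuples
`b 0, …, b (r - 1)` such that every subset of them is cut out by some instance `φ(a; y)`. -/
def HasIndependenceProperty {n k : ℕ} (φ : L.Formula (Fin n ⊕ Fin k)) : Prop :=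
  ∃ M : Theory.ModelType.{u, v, max u v} T, ∀ r : ℕ, ∃ b : Fin r → Fin k → M,
    ∀ S : Set (Fin r), ∃ a : Fin n → M, ∀ i, φ.Realize (Sum.elim a (b i)) ↔ i ∈ S

/-- `T` is dependent: no formula `φ(x; y)` has the independence property in `T`. -/
def DependentTheory : Prop :=
  ∀ (n k : ℕ) (φ : L.Formula (Fin n ⊕ Fin k)), ¬ HasIndependenceProperty T φ

end Theories

end DpRank

namespace DpRank

open FirstOrder FirstOrder.Language Cardinal

-- Passing from one variable to many is an induction on the length of the tuple. Adding one element
-- `a` to the base must preserve mutual indiscernibility on as many sequences as before. Suppose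
-- every family of `μ` mutually indiscernible sequences has a member indiscernible over `Aa`. Take a
-- maximal disjoint collection of finite subfamilies that are not mutually indiscernible over `Aa`.
-- Each can be concatenated into one sequence of longer tuples that is not indiscernible over `Aa`,
-- and the concatenations are still mutually indiscernible over `A` (`exists_amalgamation`). So
-- there are fewer than `μ` of them. Deleting them leaves `μ` sequences, mutually indiscernible over
-- `Aa` by maximality (`exists_subfamily_mutuallyIndiscernible`). Then the remaining coordinates are
-- handled over `Aa` (`FamilyBound.of_one`).
--
-- For dependence, bounds on families are compared with the independence property for tuples `x` of
-- fixed length. If more sequences than there are formulas all fail to be indiscernible over `Aa`,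
-- infinitely many fail through one `φ(x; y)`; mutual indiscernibility lets the two truth values be
-- chosen independently, so `φ` has the independence property
-- (`familyBound_of_not_hasIndependenceProperty`). Conversely, Ramsey's theorem and an ultrapower
-- stretch a shattered sequence to an indiscernible one of any length, cut into blocks of type `ω`,
-- where one tuple separates the first two terms of every block (`exists_not_isIndiscernible`).

/-- Two valuations have the same type: they satisfy the same formulas. -/
def SameType (L : FirstOrder.Language.{u, v}) {N : Type*} [L.Structure N] {α : Type*}
    (x y : α → N) : Prop :=
  ∀ φ : L.Formula α, φ.Realize x ↔ φ.Realize y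

-- Equality of types of valuations

section SameType

variable {L : FirstOrder.Language.{u, v}} {N : Type*} [L.Structure N] {α β : Type*}

/-- A formula only depends on the values of finitely many variables. -/
theorem exists_finset_realize_congr (φ : L.Formula α) : ∃ s : Finset α, ∀ x y : α → N,
    (∀ i ∈ s, x i = y i) → (φ.Realize x ↔ φ.Realize y) := by
  classical
  refine ⟨φ.freeVarFinset, fun x y h => ?_⟩
  exact (BoundedFormula.realize_restrictFreeVar (φ := φ) (f := fun i => i.1)
    (v := x) x (fun _ => rfl)).symm.trans
    (BoundedFormula.realize_restrictFreeVar (φ := φ) (f := fun i => i.1)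
    (v := x) y (fun a => h a a.2))

theorem SameType.refl (x : α → N) : SameType L x x := fun _ => Iff.rfl

theorem SameType.symm {x y : α → N} (h : SameType L x y) : SameType L y x :=
  fun φ => (h φ).symm

theorem SameType.trans {x y z : α → N} (h : SameType L x y) (h' : SameType L y z) :
    SameType L x z :=
  fun φ => (h φ).trans (h' φ)

theorem SameType.comp {x y : α → N} (h : SameType L x y) (g : β → α) :
    SameType L (x ∘ g) (y ∘ g) := by
  intro φ
  rw [← Formula.realize_relabel, ← Formula.realize_relabel]
  exact h _

theorem SameType.of_comp {x y : α → N} {x' y' : β → N} (h : SameType L x y) (g : β → α)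
    (hx : ∀ i, x' i = x (g i)) (hy : ∀ i, y' i = y (g i)) : SameType L x' y' := by
  rw [show x' = x ∘ g from funext hx, show y' = y ∘ g from funext hy]
  exact h.comp g

/-- Having the same type is a property of finite character. -/
theorem SameType.of_finset {x y : α → N}
    (h : ∀ s : Finset α, ∃ x' y' : α → N, SameType L x' y' ∧ ∀ i ∈ s, x' i = x i ∧ y' i = y i) :
    SameType L x y := by
  intro φ
  obtain ⟨s, hs⟩ := exists_finset_realize_congr (N := N) φ
  obtain ⟨x', y', hxy, h⟩ := h s
  rw [← hs x' x fun i hi => (h i hi).1, ← hs y' y fun i hi => (h i hi).2]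
  exact hxy φ

/-- Having the same type may be checked on finite sets of variables. -/
theorem SameType.of_restrict {x y : α → N}
    (h : ∀ s : Finset α, SameType L (fun i : s => x i) (fun i : s => y i)) : SameType L x y := by
  classical
  intro φ
  exact (BoundedFormula.realize_restrictFreeVar (φ := φ) (f := id)
    (v := fun i => x i.1) x (fun _ => rfl)).symm.trans
    ((h φ.freeVarFinset (φ.restrictFreeVar id)).trans
      (BoundedFormula.realize_restrictFreeVar (φ := φ) (f := id)
        (v := fun i => y i.1) y (fun _ => rfl)))

end SameType

theorem exists_strictMono_extend {k : ℕ} {s : Fin k → ℕ} (hs : StrictMono s) :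
    ∃ s' : ℕ → ℕ, StrictMono s' ∧ ∀ i : Fin k, s' i = s i := by
  obtain ⟨c, hc⟩ : ∃ c, ∀ i, s i < c := by
    obtain ⟨c, hc⟩ := (Set.finite_range s).bddAbove
    exact ⟨c + 1, fun i => Nat.lt_succ_of_le (hc ⟨i, rfl⟩)⟩
  refine ⟨fun n => if h : n < k then s ⟨n, h⟩ else c + n, fun a b hab => ?_, fun i => by simp⟩
  by_cases hb : b < k
  · simpa [hb, hab.trans hb] using hs (show (⟨a, hab.trans hb⟩ : Fin k) < ⟨b, hb⟩ from hab)
  · by_cases ha : a < k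
    · have := hc ⟨a, ha⟩
      simp only [ha, hb, dite_true, dite_false]
      omega
    · simp only [ha, hb, dite_false]
      omega

-- Indiscernibility in terms of subsequences

section Indiscernible

variable {L : FirstOrder.Language.{u, v}} {N : Type*} [L.Structure N] {B : Set N}

/-- The valuation of parameters by themselves and of other variables by the terms of a
subsequence. -/
def seqVal (B : Set N) {m : ℕ} (I : ℕ → Fin m → N) (s : ℕ → ℕ) : B ⊕ (ℕ × Fin m) → N :=
  Sum.elim (fun b : B => (b : N)) fun q => I (s q.1) q.2

/-- The valuation of parameters by themselves and of other variables by the terms of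
subsequences of the members of a family. -/
def famVal (B : Set N) {ι : Type*} {m : ι → ℕ} (I : ∀ j, ℕ → Fin (m j) → N) (s : ι → ℕ → ℕ) :
    B ⊕ (Σ j, ℕ × Fin (m j)) → N :=
  Sum.elim (fun b : B => (b : N)) fun q => I q.1 (s q.1 q.2.1) q.2.2

/-- A formula sees finitely many indices, and a finite increasing tuple extends to a strictly
increasing map on `ℕ`. In this form, consequences of indiscernibility become changes of variables.
-/
theorem isIndiscernible_iff {m : ℕ} {I : ℕ → Fin m → N} :
    IsIndiscernible L B I ↔ ∀ s : ℕ → ℕ, StrictMono s →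
      SameType L (seqVal B I s) (seqVal B I id) := by
  classical
  constructor
  · intro h s hs
    refine .of_finset fun F => ?_
    obtain ⟨K, hK⟩ : ∃ K : ℕ, ∀ q, Sum.inr q ∈ F → q.1 < K + 1 := by
      obtain ⟨K, hK⟩ := (((F : Set (B ⊕ (ℕ × Fin m))).toFinite.image
        (Sum.elim (fun _ => 0) fun q => q.1))).bddAbove
      exact ⟨K, fun q hq => Nat.lt_succ_of_le (hK ⟨_, hq, rfl⟩)⟩
    -- Reduction modulo `K + 1` only makes the map total; it fixes the indices occurring in `F`.
    let g : B ⊕ (ℕ × Fin m) → B ⊕ (Fin (K + 1) × Fin m) :=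
      Sum.map id fun q => (Fin.ofNat (K + 1) q.1, q.2)
    have key := SameType.comp (L := L) (fun φ => h (K + 1) φ (fun i => s i) (fun i => i)
      (fun i j hij => hs hij) (fun i j hij => hij)) g
    refine ⟨_, _, key, ?_⟩
    rintro (b | q) hq
    · exact ⟨rfl, rfl⟩
    · simp [g, seqVal, Nat.mod_eq_of_lt (hK q hq)]
  · intro h k φ s t hs ht
    have key : ∀ s : Fin k → ℕ, StrictMono s →
        (φ.Realize (Sum.elim (fun b : B => (b : N)) fun q => I (s q.1) q.2) ↔
        φ.Realize (Sum.elim (fun b : B => (b : N)) fun q => I q.1 q.2)) := by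
      intro s hs
      obtain ⟨s', hs', hs''⟩ := exists_strictMono_extend hs
      refine (h s' hs').of_comp (Sum.map id fun q => ((q.1 : ℕ), q.2)) ?_ ?_ φ <;>
      rintro (b | q) <;> simp [seqVal, hs'']
    rw [key s hs, key t ht]

/-- Finitely many sequences matter at a time, and they may be thinned one by one: while one is
changed, the terms of the others are parameters over which it is indiscernible. -/
theorem mutuallyIndiscernible_iff {ι : Type*} {m : ι → ℕ} {I : ∀ j, ℕ → Fin (m j) → N} :
    MutuallyIndiscernible L B I ↔ ∀ s : ι → ℕ → ℕ, (∀ j, StrictMono (s j)) →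
      SameType L (famVal B I s) (famVal B I fun _ => id) := by
  classical
  constructor
  · intro h
    have fin : ∀ (F : Finset ι) (s : ι → ℕ → ℕ), (∀ j, StrictMono (s j)) →
        (∀ j, j ∉ F → s j = id) → SameType L (famVal B I s) (famVal B I fun _ => id) := by
      intro F
      induction F using Finset.induction_on with
      | empty =>
        intro s _ hs
        rw [show s = fun _ => id from funext fun j => hs j (by simp)]
        exact .refl _
      | insert j F hj ih =>
        intro s hs hF
        refine SameType.trans ?_ (ih (Function.update s j id) ?_ ?_)
        · have mem : ∀ i n r, i ≠ j → I i n r ∈ B ∪ ⋃ i ∈ {i | i ≠ j}, seqSet (I i) :=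
            fun i n r hi => Or.inr (Set.mem_biUnion hi ⟨(n, r), rfl⟩)
          refine (isIndiscernible_iff.1 (h j) (s j) (hs j)).of_comp
            (Sum.elim (fun b => Sum.inl ⟨b, Or.inl b.2⟩) fun q =>
              if hq : q.1 = j then Sum.inr (q.2.1, hq ▸ q.2.2) else
                Sum.inl ⟨I q.1 (s q.1 q.2.1) q.2.2, mem _ _ _ hq⟩) ?_ ?_
          · rintro (b | ⟨i, n, r⟩)
            · rfl
            · by_cases hi : i = j
              · subst hi
                simp [famVal, seqVal]
              · simp [famVal, seqVal, hi]
          · rintro (b | ⟨i, n, r⟩)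
            · rfl
            · by_cases hi : i = j
              · subst hi
                simp [famVal, seqVal]
              · simp [famVal, seqVal, hi]
        · intro i
          by_cases hi : i = j
          · subst hi
            simpa using strictMono_id
          · simpa [hi] using hs i
        · intro i hi
          by_cases hij : i = j
          · subst hij
            simp
          · simpa [hij] using hF i (by simp [hi, hij])
    intro s hs
    refine .of_finset fun F => ?_
    let G : Finset ι := F.biUnion (Sum.elim (fun _ => ∅) fun q => {q.1})
    refine ⟨_, _, fin G (fun j => if j ∈ G then s j else id) ?_ ?_, ?_⟩
    · intro j
      by_cases hj : j ∈ G
      · simpa [hj] using hs j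
      · simpa [hj] using strictMono_id
    · intro j hj
      simp [hj]
    · rintro (b | q) hq
      · exact ⟨rfl, rfl⟩
      · have : q.1 ∈ G := Finset.mem_biUnion.2 ⟨_, hq, by simp⟩
        simp [famVal, this]
  · intro h j
    rw [isIndiscernible_iff]
    intro s hs
    -- Every parameter is the value of a variable unaffected by thinning the `j`-th sequence.
    have pos : ∀ b : ↥(B ∪ ⋃ i ∈ {i | i ≠ j}, seqSet (I i)), ∃ c : B ⊕ (Σ j, ℕ × Fin (m j)),
        ∀ s : ℕ → ℕ, famVal B I (Function.update (fun _ => id) j s) c = b := by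
      rintro ⟨b, hb | hb⟩
      · exact ⟨Sum.inl ⟨b, hb⟩, fun _ => rfl⟩
      · obtain ⟨i, hi, ⟨n, r⟩, rfl⟩ := Set.mem_iUnion₂.1 hb
        exact ⟨Sum.inr ⟨i, n, r⟩, fun s => by simp [famVal, Function.update_of_ne hi]⟩
    choose g hg using pos
    refine (h (Function.update (fun _ => id) j s) fun i => ?_).of_comp
      (Sum.elim g fun q => Sum.inr ⟨j, q⟩) ?_ ?_
    · by_cases hi : i = j
      · subst hi
        simpa using hs
      · simpa [hi] using strictMono_id
    · rintro (b | q)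
      · exact (hg b s).symm
      · simp [famVal, seqVal]
    · rintro (b | q)
      · have := hg b id
        rw [Function.update_eq_self_iff.2 rfl] at this
        exact this.symm
      · simp [famVal, seqVal]

/-- Two choices of subsequences of mutually indiscernible sequences have the same type. -/
theorem MutuallyIndiscernible.sameType {ι : Type*} {m : ι → ℕ} {I : ∀ j, ℕ → Fin (m j) → N}
    (h : MutuallyIndiscernible L B I) {s t : ι → ℕ → ℕ} (hs : ∀ j, StrictMono (s j))
    (ht : ∀ j, StrictMono (t j)) : SameType L (famVal B I s) (famVal B I t) :=
  (mutuallyIndiscernible_iff.1 h s hs).trans (mutuallyIndiscernible_iff.1 h t ht).symm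

theorem MutuallyIndiscernible.comp {ι κ : Type*} {m : ι → ℕ} {I : ∀ j, ℕ → Fin (m j) → N}
    (h : MutuallyIndiscernible L B I) {g : κ → ι} (hg : Function.Injective g) :
    MutuallyIndiscernible L B fun i => I (g i) := by
  rw [mutuallyIndiscernible_iff]
  intro s hs
  classical
  refine (mutuallyIndiscernible_iff.1 h (Function.extend g s fun _ => id) fun j => ?_).of_comp
    (Sum.map id fun q => ⟨g q.1, q.2⟩) ?_ ?_
  · by_cases hj : ∃ i, g i = j
    · obtain ⟨i, rfl⟩ := hj
      rw [hg.extend_apply]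
      exact hs i
    · rw [Function.extend_apply' _ _ _ hj]
      exact strictMono_id
  · rintro (b | ⟨i, n, r⟩)
    · rfl
    · simp [famVal, hg.extend_apply]
  · rintro (b | q) <;> rfl

end Indiscernible

-- Amalgamating finite groups of sequences

section Amalgamation

variable {L : FirstOrder.Language.{u, v}} {N : Type*} [L.Structure N] {A D : Set N}

/-- A family that is not mutually indiscernible has a finite subfamily that is not. -/
theorem exists_finset_not_mutuallyIndiscernible {ι : Type*} {m : ι → ℕ}
    {I : ∀ j, ℕ → Fin (m j) → N} (h : ¬ MutuallyIndiscernible L D I) :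
    ∃ F : Finset ι, ¬ MutuallyIndiscernible L D fun j : F => I j := by
  classical
  by_contra! hF
  refine h (mutuallyIndiscernible_iff.2 fun s hs => .of_restrict fun G => ?_)
  let F : Finset ι := G.biUnion (Sum.elim (fun _ => ∅) fun q => {q.1})
  have hGF : ∀ q, Sum.inr q ∈ G → q.1 ∈ F := fun q hq => Finset.mem_biUnion.2 ⟨_, hq, by simp⟩
  let g : G → D ⊕ (Σ j : F, ℕ × Fin (m j)) := fun
    | ⟨Sum.inl b, _⟩ => Sum.inl b
    | ⟨Sum.inr q, hq⟩ => Sum.inr ⟨⟨q.1, hGF q hq⟩, q.2⟩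
  refine (mutuallyIndiscernible_iff.1 (hF F) (fun j => s j) fun j => hs j).of_comp g ?_ ?_ <;>
  rintro ⟨b | q, hq⟩ <;> rfl

/-- A family of finitely many sequences that is not mutually indiscernible over `D` has
subsequences in which an initial segment and the part following it have different types. -/
theorem exists_shift_of_not_mutuallyIndiscernible {ι : Type*} [Finite ι] {m : ι → ℕ}
    {I : ∀ j, ℕ → Fin (m j) → N} (h : ¬ MutuallyIndiscernible L D I) :
    ∃ (K : ℕ) (w : ι → ℕ → ℕ), 0 < K ∧ (∀ j, StrictMono (w j)) ∧
      ∃ φ : L.Formula (D ⊕ (Σ j, ℕ × Fin (m j))),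
        (∀ x y : D ⊕ (Σ j, ℕ × Fin (m j)) → N, (∀ b, x (Sum.inl b) = y (Sum.inl b)) →
          (∀ j n r, n < K → x (Sum.inr ⟨j, n, r⟩) = y (Sum.inr ⟨j, n, r⟩)) →
            (φ.Realize x ↔ φ.Realize y)) ∧
        ¬ (φ.Realize (famVal D I w) ↔ φ.Realize (famVal D I fun j n => w j (K + n))) := by
  classical
  rw [mutuallyIndiscernible_iff] at h
  simp only [SameType] at h
  push Not at h
  obtain ⟨s, hs, φ, hφ⟩ := h
  obtain ⟨F, hF⟩ := exists_finset_realize_congr (N := N) φ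
  obtain ⟨K, hK0, hK⟩ : ∃ K : ℕ, 0 < K ∧ ∀ q, Sum.inr q ∈ F → q.2.1 < K := by
    obtain ⟨K, hK⟩ := (((F : Set (D ⊕ (Σ j, ℕ × Fin (m j)))).toFinite.image
      (Sum.elim (fun _ => 0) fun q => q.2.1))).bddAbove
    exact ⟨K + 1, K.succ_pos, fun q hq => Nat.lt_succ_of_le (hK ⟨_, hq, rfl⟩)⟩
  have hloc : ∀ x y : D ⊕ (Σ j, ℕ × Fin (m j)) → N, (∀ b, x (Sum.inl b) = y (Sum.inl b)) →
      (∀ j n r, n < K → x (Sum.inr ⟨j, n, r⟩) = y (Sum.inr ⟨j, n, r⟩)) →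
        (φ.Realize x ↔ φ.Realize y) := by
    refine fun x y hb hq => hF x y ?_
    rintro (b | q) hi
    · exact hb b
    · exact hq _ _ _ (hK q hi)
  -- The terms from `c` on lie beyond the first `K` terms of both `s` and the identity. Since `φ`
  -- distinguishes these two, it distinguishes one of them from that tail, and `w` is this one
  -- followed by the tail.
  obtain ⟨c, hc⟩ : ∃ c : ℕ, ∀ j, s j K ≤ c := by
    obtain ⟨c, hc⟩ := (Set.finite_range fun j => s j K).bddAbove
    exact ⟨c, fun j => hc ⟨j, rfl⟩⟩
  have key : ∀ t : ι → ℕ → ℕ, (∀ j, StrictMono (t j)) → (∀ j, t j K ≤ c) →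
      ¬ (φ.Realize (famVal D I t) ↔ φ.Realize (famVal D I fun _ n => c + n)) →
      ∃ w : ι → ℕ → ℕ, (∀ j, StrictMono (w j)) ∧
        ¬ (φ.Realize (famVal D I w) ↔ φ.Realize (famVal D I fun j n => w j (K + n))) := by
    intro t ht htc hne
    let w : ι → ℕ → ℕ := fun j n => if n < K then t j n else c + (n - K)
    have h1 : φ.Realize (famVal D I w) ↔ φ.Realize (famVal D I t) :=
      hloc _ _ (fun b => rfl) fun j n r hn => by simp [famVal, w, hn]
    have h2 : φ.Realize (famVal D I fun j n => w j (K + n)) ↔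
        φ.Realize (famVal D I fun _ n => c + n) :=
      hloc _ _ (fun b => rfl) fun j n r hn => by simp [famVal, w]
    refine ⟨w, fun j a b hab => ?_, by rwa [h1, h2]⟩
    by_cases hb : b < K
    · simpa [w, hb, hab.trans hb] using ht j hab
    · by_cases ha : a < K
      · have := (ht j ha).trans_le (htc j)
        simp only [w, ha, hb, if_true, if_false]
        omega
      · simp only [w, ha, hb, if_false]
        omega
  by_cases h1 : φ.Realize (famVal D I s) ↔ φ.Realize (famVal D I fun _ n => c + n)
  · obtain ⟨w, hw, hne⟩ := key (fun _ => id) (fun _ => strictMono_id)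
      (fun j => ((hs j).id_le K).trans (hc j)) (by tauto)
    exact ⟨K, w, hK0, hw, φ, hloc, hne⟩
  · obtain ⟨w, hw, hne⟩ := key s hs hc h1
    exact ⟨K, w, hK0, hw, φ, hloc, hne⟩

/-- Grouping finitely many sequences at a time into one sequence of longer tuples: if the members
of a mutually indiscernible family are grouped into finite groups, none of which is mutually
indiscernible over `D`, then there is a mutually indiscernible family with one member for each
group, none of whose members is indiscernible over `D`. -/
theorem exists_amalgamation {κ : Type*} {ι : κ → Type*} [∀ i, Finite (ι i)]
    {m : (Σ i, ι i) → ℕ} {I : ∀ j, ℕ → Fin (m j) → N} (hI : MutuallyIndiscernible L A I)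
    (hbad : ∀ i, ¬ MutuallyIndiscernible L D fun j : ι i => I ⟨i, j⟩) :
    ∃ (m' : κ → ℕ) (J : ∀ i, ℕ → Fin (m' i) → N), MutuallyIndiscernible L A J ∧
      ∀ i, ¬ IsIndiscernible L D (J i) := by
  classical
  choose K w hK hw φ hloc hφ using fun i => exists_shift_of_not_mutuallyIndiscernible (hbad i)
  have e : ∀ i, ∃ m', Nonempty ((Σ j : ι i, Fin (K i) × Fin (m ⟨i, j⟩)) ≃ Fin m') :=
    fun i => (Finite.exists_equiv_fin _)
  choose m' e using e
  replace e := fun i => (e i).some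
  -- The `l`-th term of `J i` concatenates the `l`-th blocks of `K i` consecutive terms of all the
  -- sequences in the group, taken along `w`.
  let J : ∀ i, ℕ → Fin (m' i) → N := fun i l r =>
    I ⟨i, ((e i).symm r).1⟩ (w i ((e i).symm r).1 (l * K i + ((e i).symm r).2.1)) ((e i).symm r).2.2
  have hJ : ∀ i l p, J i l (e i p) = I ⟨i, p.1⟩ (w i p.1 (l * K i + p.2.1)) p.2.2 := by
    intro i l p
    exact congrArg (fun p : Σ j : ι i, Fin (K i) × Fin (m ⟨i, j⟩) =>
      I ⟨i, p.1⟩ (w i p.1 (l * K i + p.2.1)) p.2.2) ((e i).symm_apply_apply p)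
  refine ⟨m', J, ?_, fun i hi => ?_⟩
  · rw [mutuallyIndiscernible_iff]
    intro σ hσ
    -- Choosing blocks by `σ` amounts to choosing terms by `τ σ`, so thinning `J` is a case of
    -- thinning `I`.
    let τ : (κ → ℕ → ℕ) → (Σ i, ι i) → ℕ → ℕ := fun σ j n =>
      w j.1 j.2 (σ j.1 (n / K j.1) * K j.1 + n % K j.1)
    have hτ : ∀ σ : κ → ℕ → ℕ, (∀ i, StrictMono (σ i)) → ∀ j, StrictMono (τ σ j) := by
      intro σ hσ j
      refine strictMono_nat_of_lt_succ fun n => hw _ _ ?_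
      have hpos := hK j.1
      have h1 := Nat.div_add_mod n (K j.1)
      have h2 := Nat.div_add_mod (n + 1) (K j.1)
      have h3 := Nat.mod_lt n hpos
      rcases (Nat.div_le_div_right (c := K j.1) n.le_succ).eq_or_lt with h | h
      · rw [Nat.succ_eq_add_one] at h
        rw [← h] at h2 ⊢
        omega
      · have h4 : σ j.1 (n / K j.1) + 1 ≤ σ j.1 ((n + 1) / K j.1) := hσ j.1 h
        have h5 := Nat.mul_le_mul_right (K j.1) h4
        rw [add_mul, one_mul] at h5
        omega
    have hval : ∀ (σ : κ → ℕ → ℕ) (q : A ⊕ (Σ i, ℕ × Fin (m' i))), famVal A J σ q =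
        famVal A I (τ σ) (Sum.map id (fun q => ⟨⟨q.1, ((e q.1).symm q.2.2).1⟩,
          q.2.1 * K q.1 + ((e q.1).symm q.2.2).2.1, ((e q.1).symm q.2.2).2.2⟩) q) := by
      rintro σ (b | ⟨i, l, r⟩)
      · rfl
      · have h3 := ((e i).symm r).2.1.2
        simp only [famVal, J, τ, Sum.map_inr, Sum.elim_inr]
        rw [mul_comm l, Nat.mul_add_div (hK i), Nat.mul_add_mod, Nat.mod_eq_of_lt h3,
          Nat.div_eq_of_lt h3, add_zero]
    exact (hI.sameType (hτ σ hσ) (hτ _ fun _ => strictMono_id)).of_comp _ (hval σ) (hval _)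
  · refine hφ i ?_
    -- The shift takes block `0` to block `1`, which `φ i` distinguishes. The remainder modulo `K i`
    -- below is harmless, as `φ i` reads only the indices less than `K i`.
    have h := isIndiscernible_iff.1 hi (fun n => n + 1) fun a b hab => by simpa using hab
    have h' := (h.comp (Sum.map id fun q : Σ j : ι i, ℕ × Fin (m ⟨i, j⟩) =>
      (0, e i ⟨q.1, ⟨q.2.1 % K i, Nat.mod_lt _ (hK i)⟩, q.2.2⟩))) (φ i)
    refine Iff.trans (hloc i _ _ (fun b => by rfl) ?_) (h'.symm.trans (hloc i _ _ (fun b => by rfl) ?_))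
    · intro j n r hn
      simp [famVal, seqVal, hJ, Nat.mod_eq_of_lt hn]
    · intro j n r hn
      simp [famVal, seqVal, hJ, Nat.mod_eq_of_lt hn]

end Amalgamation

theorem IsIndiscernible.mono {L : FirstOrder.Language.{u, v}} {N : Type*} [L.Structure N]
    {B C : Set N} {m : ℕ} {I : ℕ → Fin m → N} (h : IsIndiscernible L C I) (hBC : B ⊆ C) :
    IsIndiscernible L B I := by
  rw [isIndiscernible_iff] at h ⊢
  refine fun s hs => (h s hs).of_comp (Sum.map (Set.inclusion hBC) id) ?_ ?_ <;>
  rintro (b | q) <;> rfl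

/-- If every mutually indiscernible family of size `μ` has a member that is indiscernible over
`D`, then every mutually indiscernible family of size `μ` has a subfamily of the same size that is
mutually indiscernible over `D`. -/
theorem exists_subfamily_mutuallyIndiscernible.{w} {L : FirstOrder.Language.{u, v}} {N : Type*}
    [L.Structure N] {A D : Set N} {μ : Cardinal.{w}} (hμ : ℵ₀ ≤ μ)
    (h : ∀ κ : Type w, #κ = μ → ∀ (m : κ → ℕ) (J : ∀ i, ℕ → Fin (m i) → N),
      MutuallyIndiscernible L A J → ∃ i, IsIndiscernible L D (J i))
    {ι : Type w} (hι : #ι = μ) {m : ι → ℕ} {I : ∀ j, ℕ → Fin (m j) → N}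
    (hI : MutuallyIndiscernible L A I) :
    ∃ S : Set ι, #S = μ ∧ MutuallyIndiscernible L D fun j : S => I j := by
  classical
  obtain ⟨𝓕, h𝓕⟩ := zorn_subset {𝓕 : Set (Finset ι) | 𝓕.PairwiseDisjoint id ∧
      ∀ F ∈ 𝓕, ¬ MutuallyIndiscernible L D fun j : F => I j} (by
    refine fun c hc hchain => ⟨⋃₀ c, ⟨?_, ?_⟩, fun s hs => Set.subset_sUnion_of_mem hs⟩
    · exact (Set.pairwiseDisjoint_sUnion hchain.directedOn).2 fun 𝓕 h => (hc h).1
    · rintro F ⟨𝓕, h, hF⟩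
      exact (hc h).2 F hF)
  obtain ⟨hdisj, hbad⟩ := h𝓕.prop
  -- Otherwise `μ` of these disjoint groups amalgamate to a family contradicting `h`.
  have hlt : #𝓕 < μ := by
    by_contra! hle
    obtain ⟨C, hC, hCμ⟩ := le_mk_iff_exists_subset.1 hle
    let g : (Σ F : C, (F : Finset ι)) → ι := fun q => q.2
    have hg : Function.Injective g := by
      rintro ⟨F, j⟩ ⟨F', j'⟩ hjj
      have hjj : (j : ι) = j' := hjj
      obtain rfl : F = F' := by
        refine Subtype.ext (hdisj.elim (hC F.2) (hC F'.2) fun hd => ?_)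
        exact Finset.disjoint_left.1 hd j.2 (hjj ▸ j'.2)
      rw [Subtype.ext hjj]
    obtain ⟨m', J, hJ, hJ'⟩ := exists_amalgamation (D := D) (hI.comp hg)
      fun F => hbad F (hC F.2)
    obtain ⟨i, hi⟩ := h C hCμ m' J hJ
    exact hJ' i hi
  let U : Set ι := ⋃ F : 𝓕, ((F : Finset ι) : Set ι)
  have hU : #U < μ := by
    -- For `μ = ℵ₀` the bound `#𝓕 * ℵ₀` would be too weak; there `U` is a finite union of finite
    -- sets.
    rcases hμ.eq_or_lt with rfl | hμ
    · have : Finite 𝓕 := lt_aleph0_iff_finite.1 hlt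
      exact (Set.finite_iUnion fun F : 𝓕 => (F : Finset ι).finite_toSet).lt_aleph0
    · refine (mk_iUnion_le_sum_mk.trans (sum_le_sum _ (fun _ => ℵ₀) fun F => ?_)).trans_lt ?_
      · exact (F : Finset ι).finite_toSet.lt_aleph0.le
      · rw [sum_const, lift_id, lift_aleph0]
        exact mul_lt_of_lt hμ.le hlt hμ
  have : Infinite ι := infinite_iff.2 (hι ▸ hμ)
  refine ⟨Uᶜ, (mk_compl_of_infinite U (hι ▸ hU)).trans hι, ?_⟩
  by_contra hne
  obtain ⟨F, hF⟩ := exists_finset_not_mutuallyIndiscernible hne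
  let F' : Finset ι := F.map (Function.Embedding.subtype _)
  have hF'U : ∀ j ∈ F', j ∉ U := by
    intro j hj
    obtain ⟨j, _, rfl⟩ := Finset.mem_map.1 hj
    exact j.2
  have hF' : ¬ MutuallyIndiscernible L D fun j : F' => I j := by
    intro hm
    refine hF (hm.comp (g := fun j : F => (⟨j, Finset.mem_map_of_mem _ j.2⟩ : F')) ?_)
    intro i j hij
    exact Subtype.ext (Subtype.ext (congrArg (fun j : F' => (j : ι)) hij))
  have hmem : F' ∈ 𝓕 := by
    refine h𝓕.le_of_ge ⟨?_, ?_⟩ (Set.subset_insert F' 𝓕) (Set.mem_insert _ _)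
    · refine hdisj.insert fun G hG _ => Finset.disjoint_left.2 fun j hj hjG => ?_
      exact hF'U j hj (Set.mem_iUnion.2 ⟨⟨G, hG⟩, hjG⟩)
    · rintro G (rfl | hG)
      · exact hF'
      · exact hbad G hG
  -- By maximality `F'` belongs to `𝓕`, hence lies in `U`, which it avoids. So it is empty, and an
  -- empty family is mutually indiscernible.
  refine hF' fun j => ?_
  exact absurd (Set.mem_iUnion.2 ⟨⟨F', hmem⟩, j.2⟩) (hF'U j j.2)

/-- In models of `T`, every family of `μ` sequences mutually indiscernible over a set `A` has a
member that remains indiscernible after adding an `n`-tuple to `A`. -/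
def FamilyBound {L : FirstOrder.Language.{u, v}} (T : L.Theory) (μ : Cardinal.{max u v})
    (n : ℕ) : Prop :=
  ∀ (N : Theory.ModelType.{u, v, max u v} T) (A : Set N) (a : Fin n → N),
    ∀ ι : Type (max u v), #ι = μ → ∀ (m : ι → ℕ) (I : ∀ j, ℕ → Fin (m j) → N),
      MutuallyIndiscernible L A I → ∃ j, IsIndiscernible L (A ∪ Set.range a) (I j)

-- Bounds on families and dp-rank

section FamilyBound

variable {L : FirstOrder.Language.{u, v}} {T : L.Theory} {μ : Cardinal.{max u v}}

/-- Bounds for single elements yield the same bounds for finite tuples. -/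
theorem FamilyBound.of_one (hμ : ℵ₀ ≤ μ) (h : FamilyBound T μ 1) (n : ℕ) : FamilyBound T μ n := by
  induction n with
  | zero =>
    intro N A a ι hι m I hI
    have : Nonempty ι := mk_ne_zero_iff.1 (hι ▸ (aleph0_pos.trans_le hμ).ne')
    refine ⟨Classical.arbitrary ι, (hI _).mono ?_⟩
    simp [Set.range_eq_empty a]
  | succ n ih =>
    intro N A a ι hι m I hI
    obtain ⟨S, hS, hIS⟩ := exists_subfamily_mutuallyIndiscernible hμ
      (fun κ hκ m J hJ => h N A (fun _ => a 0) κ hκ m J hJ) hι hI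
    have hrange : Set.range (fun _ : Fin 1 => a 0) = {a 0} := Set.range_const
    rw [hrange] at hIS
    obtain ⟨j, hj⟩ := ih N (A ∪ {a 0}) (Fin.tail a) S hS _ _ hIS
    refine ⟨j, hj.mono ?_⟩
    rintro x (hx | ⟨i, rfl⟩)
    · exact Or.inl (Or.inl hx)
    · refine Fin.cases (Or.inl (Or.inr rfl)) (fun i => Or.inr ⟨i, rfl⟩) i

/-- Bounds for families yield bounds for the dp-rank. -/
theorem FamilyBound.dpRankLE {n : ℕ} (h : FamilyBound T μ n) (hμ : ℵ₀ ≤ μ) (M : Theory.ModelType.{u, v, max u v} T) (A : Set M)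
    (p : Set (L.Formula (A ⊕ Fin n))) : DpRankLE p μ := by
  intro N _ f a _ ι hι m I hI
  have : N ⊨ T := (f.theory_model_iff T).1 inferInstance
  have : Nonempty N := ⟨f (Classical.arbitrary M)⟩
  rw [add_eq_right hμ (one_le_aleph0.trans hμ)] at hι
  exact h (Theory.ModelType.of T N) (f '' A) a ι hι m I hI

/-- Every tuple realizes the empty type, and `1 + μ = μ` for infinite `μ`. -/
theorem familyBound_of_dpRankLE {n : ℕ} (hμ : ℵ₀ ≤ μ)
    (h : ∀ (M : Theory.ModelType.{u, v, max u v} T) (A : Set M),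
      DpRankLE (∅ : Set (L.Formula (A ⊕ Fin n))) μ) : FamilyBound T μ n := by
  intro N A a ι hι m I hI
  have := h N A N (ElementaryEmbedding.refl L N) a (fun φ hφ => hφ.elim) ι
    (by rw [hι, add_eq_right hμ (one_le_aleph0.trans hμ)]) m I
  have himg : (ElementaryEmbedding.refl L N) '' A = A := Set.image_id A
  rw [himg] at this
  exact this hI

end FamilyBound

theorem isPartialType_empty {L : FirstOrder.Language.{u, v}} {M : Type (max u v)} [L.Structure M]
    [Nonempty M] (A : Set M) (n : ℕ) : IsPartialType (∅ : Set (L.Formula (A ⊕ Fin n))) :=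
  fun _ h₀ _ => ⟨fun _ => Classical.arbitrary M, fun _ hφ => (h₀ hφ).elim⟩

/-- Strong dependence of a theory is determined by types in one variable. -/
theorem stronglyDependentTheory_iff {L : FirstOrder.Language.{u, v}} (T : L.Theory) :
    StronglyDependentTheory T ↔ AllTypesStronglyDependent T 1 := by
  refine ⟨fun h => h 1, fun h n M A p _ => ?_⟩
  have h1 : FamilyBound T ℵ₀ 1 :=
    familyBound_of_dpRankLE le_rfl fun M A => h M A ∅ (isPartialType_empty A 1)
  exact (h1.of_one le_rfl n).dpRankLE le_rfl
    M A p

-- Families violating the bound yield the independence property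

section

variable {L : FirstOrder.Language.{u, v}}

/-- Only finitely many of the variables of the second sort are needed in a formula. -/
theorem exists_fin_realize_iff {α β : Type*} (ψ : L.Formula (α ⊕ β)) :
    ∃ (k : ℕ) (h : Fin k → β) (φ : L.Formula (α ⊕ Fin k)),
      ∀ {N : Type*} [L.Structure N] (x : α → N) (y : β → N),
        φ.Realize (Sum.elim x (y ∘ h)) ↔ ψ.Realize (Sum.elim x y) := by
  classical
  have : Finite {b // Sum.inr b ∈ ψ.freeVarFinset} :=
    Finite.of_injective (β := ψ.freeVarFinset) (fun b => ⟨_, b.2⟩) fun b c h => by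
      simpa [Subtype.ext_iff] using h
  obtain ⟨k, ⟨e⟩⟩ := Finite.exists_equiv_fin {b // Sum.inr b ∈ ψ.freeVarFinset}
  refine ⟨k, fun i => (e.symm i).1, ψ.restrictFreeVar fun
    | ⟨Sum.inl a, _⟩ => Sum.inl a
    | ⟨Sum.inr b, h⟩ => Sum.inr (e ⟨b, h⟩), fun {N} _ x y => ?_⟩
  refine BoundedFormula.realize_restrictFreeVar _ ?_
  rintro ⟨a | b, h⟩ <;> simp

/-- By finiteness of `β` and `γ`, the existence of `z` is expressed by a single formula. -/
theorem SameType.exists_iff {N : Type*} [L.Structure N] {α β γ : Type*} [Finite β] [Finite γ]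
    {x y : α → N} (h : SameType L x y) (φ : γ → L.Formula (β ⊕ α)) :
    (∃ z : β → N, ∀ i, (φ i).Realize (Sum.elim z x)) ↔
      ∃ z : β → N, ∀ i, (φ i).Realize (Sum.elim z y) := by
  have key : ∀ x : α → N, (∃ z : β → N, ∀ i, (φ i).Realize (Sum.elim z x)) ↔
      (Formula.iExs β (BoundedFormula.iInf fun i => (φ i).relabel Sum.swap)).Realize x := by
    intro x
    have hswap : ∀ z : β → N, Sum.elim x z ∘ Sum.swap = Sum.elim z x := by
      intro z
      ext (b | a) <;> rfl
    rw [Formula.realize_iExs]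
    refine exists_congr fun z => ?_
    rw [Formula.Realize, BoundedFormula.realize_iInf]
    refine forall_congr' fun i => ?_
    rw [← hswap z]
    exact Formula.realize_relabel.symm
  rw [key, key]
  exact h _

theorem mk_sigma_formula_le (n : ℕ) :
    #(Σ k, L.Formula (Fin n ⊕ Fin k)) ≤ max ℵ₀ L.card := by
  rw [mk_sigma]
  have hle : ∀ k, #(L.Formula (Fin n ⊕ Fin k)) ≤ max ℵ₀ L.card := by
    intro k
    refine (mk_le_of_injective (f := fun φ : L.Formula (Fin n ⊕ Fin k) =>
      (⟨0, φ⟩ : Σ l, L.BoundedFormula (Fin n ⊕ Fin k) l)) ?_).trans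
      (BoundedFormula.card_le.trans (max_le (le_max_left _ _) ?_))
    · intro φ ψ h
      simpa using h
    · refine (add_le_max _ _).trans (max_le (max_le ?_ ?_) (le_max_left _ _))
      · exact le_max_of_le_left (lift_le_aleph0.2 (mk_le_aleph0))
      · simp
  refine (sum_le_sum _ (fun _ => max ℵ₀ L.card) hle).trans ?_
  rw [sum_const]
  simp

variable {T : L.Theory}

/-- If no formula `φ(x; y)` with `x` an `n`-tuple has the independence property, then families of
more sequences than there are formulas satisfy the bound for `n`-tuples. -/
theorem familyBound_of_not_hasIndependenceProperty {n : ℕ}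
    (h : ∀ (k : ℕ) (φ : L.Formula (Fin n ⊕ Fin k)), ¬ HasIndependenceProperty T φ)
    {μ : Cardinal.{max u v}} (hμ : max ℵ₀ L.card < μ) : FamilyBound T μ n := by
  classical
  intro N A a ι hι m I hI
  by_contra! hne
  -- The formula is stripped of its parameters: `a` goes into the variables `x`, and `g` records
  -- which parameters from `A` and which terms fill `y`. What is left is one of at most `max ℵ₀
  -- L.card` formulas.
  have split : ∀ j, ∃ (z : Σ k, L.Formula (Fin n ⊕ Fin k)) (g : Fin z.1 → A ⊕ ℕ × Fin (m j))
      (s t : ℕ → ℕ), StrictMono s ∧ StrictMono t ∧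
        z.2.Realize (Sum.elim a (seqVal A (I j) s ∘ g)) ∧
        ¬ z.2.Realize (Sum.elim a (seqVal A (I j) t ∘ g)) := by
    intro j
    have hj := hne j
    simp only [isIndiscernible_iff, SameType] at hj
    push Not at hj
    obtain ⟨s, hs, φ, hφ⟩ := hj
    have pos : ∀ b : ↥(A ∪ Set.range a), ∃ c : Fin n ⊕ A,
        Sum.elim a (fun b : A => (b : N)) c = b := by
      rintro ⟨b, hb | ⟨i, rfl⟩⟩
      · exact ⟨Sum.inr ⟨b, hb⟩, rfl⟩
      · exact ⟨Sum.inl i, rfl⟩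
    choose c hc using pos
    obtain ⟨k, g, ψ, hψ⟩ := exists_fin_realize_iff (φ.relabel
      (Sum.elim (fun b => Sum.map id Sum.inl (c b)) fun q => Sum.inr (Sum.inr q) :
        _ → Fin n ⊕ (A ⊕ ℕ × Fin (m j))))
    have hval : ∀ s : ℕ → ℕ, ψ.Realize (Sum.elim a (seqVal A (I j) s ∘ g)) ↔
        φ.Realize (seqVal (A ∪ Set.range a) (I j) s) := by
      intro s
      rw [hψ, Formula.realize_relabel]
      refine iff_of_eq (congrArg _ (funext ?_))
      rintro (b | q)
      · simp only [seqVal, Function.comp_apply, Sum.elim_inl]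
        rw [← hc b]
        cases c b <;> rfl
      · rfl
    rcases hφ with hφ | hφ
    · exact ⟨⟨k, ψ⟩, g, s, id, hs, strictMono_id, (hval _).2 hφ.1, fun h => hφ.2 ((hval _).1 h)⟩
    · exact ⟨⟨k, ψ⟩, g, id, s, strictMono_id, hs, (hval _).2 hφ.2, fun h => hφ.1 ((hval _).1 h)⟩
  choose z g s t hs ht hpos hneg using split
  have : Infinite ι := infinite_iff.2 (hι ▸ (le_max_left _ _).trans hμ.le)
  obtain ⟨⟨k, φ⟩, hfib⟩ := exists_infinite_fiber z
    (((mk_sigma_formula_le n).trans_lt hμ).trans_eq hι.symm)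
  refine h k φ ⟨N, fun r => ?_⟩
  have e := (Infinite.natEmbedding (z ⁻¹' {⟨k, φ⟩}))
  have split : ∀ i : Fin r, ∃ (g : Fin k → A ⊕ ℕ × Fin (m (e i)))
      (s t : ℕ → ℕ), StrictMono s ∧ StrictMono t ∧
        φ.Realize (Sum.elim a (seqVal A (I (e i)) s ∘ g)) ∧
        ¬ φ.Realize (Sum.elim a (seqVal A (I (e i)) t ∘ g)) := by
    intro i
    have hi : z (e i) = ⟨k, φ⟩ := (e i).2
    have : ∀ w, z (e i) = w → ∃ (g : Fin w.1 → A ⊕ ℕ × Fin (m (e i)))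
      (s t : ℕ → ℕ), StrictMono s ∧ StrictMono t ∧
        w.2.Realize (Sum.elim a (seqVal A (I (e i)) s ∘ g)) ∧
        ¬ w.2.Realize (Sum.elim a (seqVal A (I (e i)) t ∘ g)) := by
      rintro _ rfl
      exact ⟨_, _, _, hs _, ht _, hpos _, hneg _⟩
    exact this _ hi
  clear hs ht hpos hneg g s t
  choose g s t hs ht hpos hneg using split
  have hI' : MutuallyIndiscernible L A fun i : Fin r => I (e i) :=
    hI.comp (g := fun i : Fin r => ((e i : z ⁻¹' {⟨k, φ⟩}) : ι))
      (Subtype.val_injective.comp (e.injective.comp Fin.val_injective))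
  -- For a pattern `S`, thin the `i`-th sequence by `s i` if `i ∈ S` and by `t i` otherwise; then
  -- `a` realizes the pattern. The unthinned family has the same type, so some `x` realizes the
  -- pattern there.
  refine ⟨fun i => seqVal A (I (e i)) id ∘ g i, fun S => ?_⟩
  let σ : Fin r → ℕ → ℕ := fun i => if i ∈ S then s i else t i
  have hσ : ∀ i, StrictMono (σ i) := by
    intro i
    by_cases hi : i ∈ S
    · simpa [σ, hi] using hs i
    · simpa [σ, hi] using ht i
  let ψ : Fin r → L.Formula (Fin n ⊕ (A ⊕ Σ i : Fin r, ℕ × Fin (m (e i)))) := fun i =>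
    φ.relabel (Sum.map id fun q => Sum.map id (fun q => ⟨i, q⟩) (g i q))
  have hψ : ∀ i (x : Fin n → N) (σ : Fin r → ℕ → ℕ),
      (ψ i).Realize (Sum.elim x (famVal A (fun i : Fin r => I (e i)) σ)) ↔
        φ.Realize (Sum.elim x (seqVal A (I (e i)) (σ i) ∘ g i)) := by
    intro i x σ
    rw [Formula.realize_relabel]
    refine iff_of_eq (congrArg _ (funext ?_))
    rintro (b | q)
    · rfl
    · simp only [Function.comp_apply, Sum.map_inr, Sum.elim_inr]
      cases g i q <;> rfl
  obtain ⟨x, hx⟩ := ((hI'.sameType hσ fun _ => strictMono_id).exists_iff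
    fun i => if i ∈ S then ψ i else (ψ i).not).1 ⟨a, fun i => by
      by_cases hi : i ∈ S
      · simpa [hi, hψ, σ] using hpos i
      · simpa [hi, hψ, σ] using hneg i⟩
  refine ⟨x, fun i => ?_⟩
  have hxi := hx i
  by_cases hi : i ∈ S
  · simpa [hi, hψ] using hxi
  · simpa [hi, hψ] using hxi

end

-- Ramsey's theorem

section Ramsey

/-- **Ramsey's theorem** for two colours. -/
theorem exists_infinite_homogeneous (r : ℕ) (χ : Finset ℕ → Prop) {X : Set ℕ} (hX : X.Infinite) :
    ∃ Y ⊆ X, Y.Infinite ∧ ∃ b : Prop, ∀ s : Finset ℕ, ↑s ⊆ Y → s.card = r → (χ s ↔ b) := by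
  induction r generalizing χ X with
  | zero =>
    refine ⟨X, subset_rfl, hX, χ ∅, fun s _ hs => ?_⟩
    rw [Finset.card_eq_zero.1 hs]
  | succ r ih =>
    have := hX.cofinite_inf_principal_neBot
    -- A nonprincipal ultrafilter on `X` colours each `s` by the colour of `insert x s` for almost
    -- all `x`. A sequence whose new terms always behave like almost all `x` reduces `χ` to this
    -- colouring `χ'` of smaller sets.
    let U := Ultrafilter.of (Filter.cofinite ⊓ Filter.principal X)
    have hU : (U : Filter ℕ) ≤ Filter.cofinite ⊓ Filter.principal X := Ultrafilter.of_le _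
    let χ' : Finset ℕ → Prop := fun s => ∀ᶠ x in U, χ (insert x s)
    have hχ' : ∀ s, ∀ᶠ x in U, (χ (insert x s) ↔ χ' s) := by
      intro s
      by_cases h : χ' s
      · exact Filter.Eventually.mono h fun x hx => iff_of_true hx h
      · exact (Ultrafilter.eventually_not.2 h).mono fun x hx => iff_of_false hx h
    have next : ∀ F : Finset ℕ, ∃ x, x ∈ X ∧ (∀ y ∈ F, y < x) ∧
        ∀ s ∈ F.powerset, (χ (insert x s) ↔ χ' s) := by
      intro F
      refine Filter.Eventually.exists (f := (U : Filter ℕ)) ?_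
      refine Filter.Eventually.and ?_ (Filter.Eventually.and ?_ ?_)
      · exact hU (Filter.mem_inf_of_right (Filter.mem_principal_self X))
      · rw [Filter.eventually_all_finset]
        intro y _
        refine hU (Filter.mem_inf_of_left ?_)
        rw [Nat.cofinite_eq_atTop]
        exact Filter.eventually_gt_atTop y
      · rw [Filter.eventually_all_finset]
        exact fun s _ => hχ' s
    choose f hfX hflt hf using next
    let F : ℕ → Finset ℕ := fun n => Nat.rec ∅ (fun _ G => insert (f G) G) n
    have hFsucc : ∀ n, F (n + 1) = insert (f (F n)) (F n) := fun n => rfl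
    have hFmono : Monotone F := monotone_nat_of_le_succ fun n => by
      rw [hFsucc]
      exact Finset.subset_insert _ _
    let x : ℕ → ℕ := fun n => f (F n)
    have hxF : ∀ {i n}, i < n → x i ∈ F n := fun {i n} hin =>
      hFmono hin (by rw [hFsucc]; exact Finset.mem_insert_self _ _)
    have hx : StrictMono x := fun i n hin => hflt _ _ (hxF hin)
    obtain ⟨Y, hYx, hY, b, hb⟩ := ih χ' (Set.infinite_range_of_injective hx.injective)
    refine ⟨Y, hYx.trans (Set.range_subset_iff.2 fun n => hfX _), hY, b, fun s hs hcard => ?_⟩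
    have hne : s.Nonempty := Finset.card_pos.1 (by omega)
    have hmax := s.max'_mem hne
    obtain ⟨n, hn⟩ := hYx (hs hmax)
    rw [← hn] at hmax
    have hsub : s.erase (x n) ⊆ F n := by
      intro y hy
      obtain ⟨hyn, hys⟩ := Finset.mem_erase.1 hy
      obtain ⟨i, rfl⟩ := hYx (hs hys)
      refine hxF (hx.lt_iff_lt.1 (lt_of_le_of_ne ?_ hyn))
      rw [hn]
      exact s.le_max' _ hys
    have h1 := hf (F n) _ (Finset.mem_powerset.2 hsub)
    rw [show insert (f (F n)) (s.erase (x n)) = s from Finset.insert_erase hmax] at h1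
    rw [h1]
    refine hb _ (fun y hy => hs (Finset.mem_of_mem_erase hy)) ?_
    rw [Finset.card_erase_of_mem hmax, hcard, Nat.add_sub_cancel]

/-- Ramsey's theorem for increasing tuples. -/
theorem exists_infinite_homogeneous_strictMono {r : ℕ} (χ : (Fin r → ℕ) → Prop) {X : Set ℕ}
    (hX : X.Infinite) : ∃ Y ⊆ X, Y.Infinite ∧ ∀ g g' : Fin r → ℕ, StrictMono g → StrictMono g' →
      (∀ i, g i ∈ Y) → (∀ i, g' i ∈ Y) → (χ g ↔ χ g') := by
  classical
  obtain ⟨Y, hYX, hY, b, hb⟩ := exists_infinite_homogeneous r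
    (fun s => ∃ g : Fin r → ℕ, StrictMono g ∧ Finset.univ.image g = s ∧ χ g) hX
  have key : ∀ g : Fin r → ℕ, StrictMono g → (∀ i, g i ∈ Y) → (χ g ↔ b) := by
    intro g hg hgY
    rw [← hb (Finset.univ.image g) (by simpa [Set.subset_def] using hgY)
      (by simp [Finset.card_image_of_injective _ hg.injective])]
    refine ⟨fun h => ⟨g, hg, rfl, h⟩, ?_⟩
    rintro ⟨g', hg', heq, h⟩
    have : Set.range g' = Set.range g := by simpa using congrArg (fun s : Finset ℕ => (s : Set ℕ)) heq
    rwa [← (hg'.range_inj hg).1 this]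
  exact ⟨Y, hYX, hY, fun g g' hg hg' hgY hgY' => (key g hg hgY).trans (key g' hg' hgY').symm⟩

theorem exists_strictMonoOn_mem {Λ : Type*} [LinearOrder Λ] (s : Finset Λ) {Y : Set ℕ}
    (hY : Y.Infinite) : ∃ h : Λ → ℕ, (∀ l, h l ∈ Y) ∧ StrictMonoOn h s := by
  -- The rank of `l` within `s` selects the element of `Y` of that rank.
  refine ⟨fun l => Nat.nth (· ∈ Y) (s.filter (· < l)).card, fun l => Nat.nth_mem_of_infinite hY _,
    fun l hl l' _ hll' => Nat.nth_strictMono hY (Finset.card_lt_card ?_)⟩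
  refine Finset.ssubset_iff_of_subset (fun x hx => ?_) |>.2 ⟨l, ?_, ?_⟩
  · rw [Finset.mem_filter] at hx ⊢
    exact ⟨hx.1, hx.2.trans hll'⟩
  · exact Finset.mem_filter.2 ⟨hl, hll'⟩
  · simp

end Ramsey

-- Shattered infinite sequences

section

variable {L : FirstOrder.Language.{u, v}}

/-- Finitely many formulas are simultaneously homogenized on an infinite subsequence. -/
theorem exists_infinite_indiscernible {M : Type*} [L.Structure M] {k : ℕ} (c : ℕ → Fin k → M)
    (Δ : Finset (Σ r, L.Formula (Fin r × Fin k))) :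
    ∃ Y : Set ℕ, Y.Infinite ∧ ∀ θ ∈ Δ, ∀ g g' : Fin θ.1 → ℕ, StrictMono g → StrictMono g' →
      (∀ i, g i ∈ Y) → (∀ i, g' i ∈ Y) →
        (θ.2.Realize (fun p => c (g p.1) p.2) ↔ θ.2.Realize fun p => c (g' p.1) p.2) := by
  classical
  induction Δ using Finset.induction_on with
  | empty => exact ⟨Set.univ, Set.infinite_univ, by simp⟩
  | insert θ Δ _ ih =>
    obtain ⟨X, hX, hΔ⟩ := ih
    obtain ⟨Y, hYX, hY, hθ⟩ := exists_infinite_homogeneous_strictMono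
      (fun g : Fin θ.1 → ℕ => θ.2.Realize fun p => c (g p.1) p.2) hX
    refine ⟨Y, hY, fun θ' hθ' => ?_⟩
    obtain rfl | hθ' := Finset.mem_insert.1 hθ'
    · exact hθ
    · exact fun g g' hg hg' hgY hgY' =>
        hΔ θ' hθ' g g' hg hg' (fun i => hYX (hgY i)) fun i => hYX (hgY' i)

/-- The diagonal embedding into an ultrapower is elementary. -/
def ultrapowerEmbedding {D : Type*} (U : Ultrafilter D) (M : Type*) [L.Structure M] [Nonempty M] :
    M ↪ₑ[L] (U : Filter D).Product fun _ => M where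
  toFun x := ((fun _ => x : D → M) : (U : Filter D).Product fun _ => M)
  map_formula' _ φ x :=
    (Ultraproduct.realize_formula_cast φ fun i _ => x i).trans Filter.eventually_const

variable {T : L.Theory}

/-- A formula with the independence property shatters an infinite sequence in some model. -/
theorem HasIndependenceProperty.exists_infinite {n k : ℕ} {φ : L.Formula (Fin n ⊕ Fin k)}
    (h : HasIndependenceProperty T φ) : ∃ (M : Theory.ModelType.{u, v, max u v} T)
      (c : ℕ → Fin k → M), ∀ S : Set ℕ, ∃ a : Fin n → M,
        ∀ i, φ.Realize (Sum.elim a (c i)) ↔ i ∈ S := by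
  obtain ⟨M, h⟩ := h
  choose b a ha using h
  let U := Filter.hyperfilter ℕ
  let N : Type (max u v) := (U : Filter ℕ).Product fun _ => M
  have : N ⊨ T := ((ultrapowerEmbedding U M).theory_model_iff T).1 inferInstance
  have : Nonempty N := ⟨ultrapowerEmbedding (L := L) U M (Classical.arbitrary M)⟩
  -- The default value is irrelevant: `i < r` holds for almost all `r`.
  let c : ℕ → Fin k → ℕ → M := fun i q r =>
    if h : i < r then b r ⟨i, h⟩ q else Classical.arbitrary M
  refine ⟨Theory.ModelType.of T N, fun i q => (c i q : (U : Filter ℕ).Product fun _ => M),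
    fun S => ⟨fun q => ((fun r => a r {i | (i : ℕ) ∈ S} q : ℕ → M) :
      (U : Filter ℕ).Product fun _ => M), fun i => ?_⟩⟩
  let x : Fin n ⊕ Fin k → ℕ → M := Sum.elim (fun q r => a r {i | (i : ℕ) ∈ S} q) (c i)
  have hx := Ultraproduct.realize_formula_cast (u := U) φ x
  have heq : (fun q => (x q : (U : Filter ℕ).Product fun _ => M)) =
      Sum.elim (fun q => ((fun r => a r {i | (i : ℕ) ∈ S} q : ℕ → M) :
        (U : Filter ℕ).Product fun _ => M)) fun q => (c i q : (U : Filter ℕ).Product fun _ => M) := by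
    ext (q | q) <;> rfl
  rw [heq] at hx
  refine hx.trans ?_
  have hev : ∀ᶠ r in (U : Filter ℕ), (φ.Realize (fun q => x q r) ↔ i ∈ S) := by
    have : ∀ᶠ r in (U : Filter ℕ), i < r :=
      Nat.hyperfilter_le_atTop (Filter.eventually_gt_atTop i)
    refine this.mono fun r hr => ?_
    refine Iff.trans (iff_of_eq (congrArg _ (funext ?_))) (ha r {i | (i : ℕ) ∈ S} ⟨i, hr⟩)
    rintro (q | q) <;> simp [x, c, hr]
  rw [Filter.eventually_congr hev, Filter.eventually_const]

end

-- Long families from the independence property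

section

variable {L : FirstOrder.Language.{u, v}}

theorem toLex_strictMono {ι : Type*} [LinearOrder ι] {s : ι → ℕ → ℕ} (hs : ∀ j, StrictMono (s j)) :
    StrictMono fun l : ι ×ₗ ℕ => toLex ((ofLex l).1, s (ofLex l).1 (ofLex l).2) := by
  intro l l' h
  rw [Prod.Lex.lt_iff] at h ⊢
  rcases h with h | ⟨h, h'⟩
  · exact Or.inl h
  · refine Or.inr ⟨h, ?_⟩
    simp only [ofLex_toLex]
    rw [h]
    exact hs _ h'

/-- Consecutive blocks of an indiscernible sequence are mutually indiscernible. -/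
theorem mutuallyIndiscernible_blocks {N : Type*} [L.Structure N] {ι : Type*} [LinearOrder ι]
    {k : ℕ} {b : ι ×ₗ ℕ → Fin k → N}
    (hb : ∀ (r : ℕ) (g g' : Fin r → ι ×ₗ ℕ), StrictMono g → StrictMono g' →
      SameType L (fun p : Fin r × Fin k => b (g p.1) p.2) fun p => b (g' p.1) p.2) :
    MutuallyIndiscernible L (∅ : Set N) (m := fun _ : ι => k) fun j l => b (toLex (j, l)) := by
  classical
  rw [mutuallyIndiscernible_iff]
  refine fun s hs => .of_restrict fun G => ?_
  let Λ : Finset (ι ×ₗ ℕ) := G.biUnion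
    (Sum.elim (fun _ => ∅) fun q => {toLex (q.1, q.2.1)})
  have hΛ : ∀ q, Sum.inr q ∈ G → toLex (q.1, q.2.1) ∈ Λ :=
    fun q hq => Finset.mem_biUnion.2 ⟨_, hq, by simp⟩
  have hg := (Λ.orderEmbOfFin rfl).strictMono
  refine (hb _ (fun i => _) _ ((toLex_strictMono hs).comp hg) hg).of_comp (fun
    | ⟨Sum.inl x, _⟩ => x.2.elim
    | ⟨Sum.inr q, hq⟩ => ((Λ.orderIsoOfFin rfl).symm ⟨_, hΛ q hq⟩, q.2.2)) ?_ ?_ <;>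
  rintro ⟨x | q, hq⟩
  · exact x.2.elim
  · simp [famVal, Finset.orderEmbOfFin]
  · exact x.2.elim
  · simp [famVal, Finset.orderEmbOfFin]

/-- If `φ` shatters a sequence in `M`, then some elementary extension contains a tuple and an
arbitrarily long mutually indiscernible family none of whose members is indiscernible over
the tuple. -/
theorem exists_not_isIndiscernible {M : Type (max u v)} [L.Structure M] [Nonempty M] {n k : ℕ}
    {φ : L.Formula (Fin n ⊕ Fin k)} {c : ℕ → Fin k → M}
    (h : ∀ S : Set ℕ, ∃ a : Fin n → M, ∀ i, φ.Realize (Sum.elim a (c i)) ↔ i ∈ S)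
    (ι : Type (max u v)) :
    ∃ (N : Type (max u v)) (_ : L.Structure N) (_ : M ↪ₑ[L] N) (a : Fin n → N)
      (I : ι → ℕ → Fin k → N), MutuallyIndiscernible L (∅ : Set N) (m := fun _ : ι => k) I ∧
        ∀ j, ¬ IsIndiscernible L (Set.range a) (I j) := by
  classical
  let _ : LinearOrder ι := linearOrderOfSTO WellOrderingRel
  -- An element of `D` is a finite part of the requirements: formulas to be homogenized and
  -- positions to be filled. Ramsey's theorem meets each part inside `c`, and the ultraproduct meets
  -- all of them.
  let D := Finset (Σ r, L.Formula (Fin r × Fin k)) × Finset (ι ×ₗ ℕ)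
  have hd : ∀ d : D, ∃ f : ι ×ₗ ℕ → ℕ, StrictMonoOn f d.2 ∧
      ∀ θ ∈ d.1, ∀ g g' : Fin θ.1 → ι ×ₗ ℕ, StrictMono g → StrictMono g' →
        (∀ i, g i ∈ d.2) → (∀ i, g' i ∈ d.2) →
        (θ.2.Realize (fun p => c (f (g p.1)) p.2) ↔ θ.2.Realize fun p => c (f (g' p.1)) p.2) := by
    intro d
    obtain ⟨Y, hY, hYθ⟩ := exists_infinite_indiscernible c d.1
    obtain ⟨f, hfY, hf⟩ := exists_strictMonoOn_mem d.2 hY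
    refine ⟨f, hf, fun θ hθ g g' hg hg' hgd hgd' => ?_⟩
    exact hYθ θ hθ (fun i => f (g i)) (fun i => f (g' i))
      (fun i j hij => hf (hgd i) (hgd j) (hg hij)) (fun i j hij => hf (hgd' i) (hgd' j) (hg' hij))
      (fun i => hfY _) fun i => hfY _
  choose f hf hfθ using hd
  -- The tuple `a d` picks out exactly the terms placed at the start of a block.
  choose a ha using fun d : D => h {x | ∃ j, toLex (j, 0) ∈ d.2 ∧ f d (toLex (j, 0)) = x}
  let U : Ultrafilter D := Ultrafilter.of Filter.atTop
  have hU : (U : Filter D) ≤ Filter.atTop := Ultrafilter.of_le _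
  have hev1 : ∀ θ, ∀ᶠ d in (U : Filter D), θ ∈ d.1 := fun θ =>
    hU ((Filter.eventually_ge_atTop ({θ}, ∅)).mono fun d hd => hd.1 (Finset.mem_singleton_self θ))
  have hev2 : ∀ l, ∀ᶠ d in (U : Filter D), l ∈ d.2 := fun l =>
    hU ((Filter.eventually_ge_atTop (∅, {l})).mono fun d hd => hd.2 (Finset.mem_singleton_self l))
  let N : Type (max u v) := (U : Filter D).Product fun _ => M
  let mk : (D → M) → N := fun x => (x : (U : Filter D).Product fun _ => M)
  have los : ∀ {α : Type} (ψ : L.Formula α) (x : α → D → M),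
      ψ.Realize (fun i => mk (x i)) ↔ ∀ᶠ d in (U : Filter D), ψ.Realize fun i => x i d :=
    fun ψ x => Ultraproduct.realize_formula_cast ψ x
  let a' : Fin n → N := fun i => mk fun d => a d i
  let b : ι ×ₗ ℕ → Fin k → N := fun l q => mk fun d => c (f d l) q
  have hφ : ∀ l, φ.Realize (Sum.elim a' (b l)) ↔
      ∀ᶠ d in (U : Filter D), ∃ j, toLex (j, 0) ∈ d.2 ∧ f d (toLex (j, 0)) = f d l := by
    intro l
    have hx := los φ (Sum.elim (fun i d => a d i) fun q d => c (f d l) q)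
    have h1 : (fun i => mk (Sum.elim (fun i d => a d i) (fun q d => c (f d l) q) i)) =
        Sum.elim a' (b l) := by
      ext (i | q) <;> rfl
    rw [h1] at hx
    refine hx.trans (Filter.eventually_congr (.of_forall fun d => ?_))
    refine Iff.trans (iff_of_eq (congrArg _ (funext ?_))) (ha d (f d l))
    rintro (i | q) <;> rfl
  refine ⟨N, inferInstance, ultrapowerEmbedding U M, a', fun j l => b (toLex (j, l)),
    mutuallyIndiscernible_blocks ?_, fun j hj => ?_⟩
  · intro r g g' hg hg' θ
    refine (los θ fun p d => c (f d (g p.1)) p.2).trans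
      (Iff.trans (Filter.eventually_congr ?_) (los θ fun p d => c (f d (g' p.1)) p.2).symm)
    filter_upwards [hev1 ⟨r, θ⟩, Filter.eventually_all.2 fun i => hev2 (g i),
      Filter.eventually_all.2 fun i => hev2 (g' i)] with d h1 h2 h3
    exact hfθ d _ h1 g g' hg hg' h2 h3
  · have hs := ((isIndiscernible_iff.1 hj (fun l => l + 1) fun x y hxy => by simpa using hxy).of_comp
      (x' := Sum.elim a' (b (toLex (j, 1)))) (y' := Sum.elim a' (b (toLex (j, 0))))
      (Sum.map (fun i => ⟨a' i, i, rfl⟩) fun q => (0, q)) (by rintro (i | q) <;> rfl)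
      (by rintro (i | q) <;> rfl)) φ
    rw [hφ, hφ] at hs
    -- `φ` holds at position `0` of the block, so by indiscernibility at position `1`. Then `f d`
    -- sends that position and the start of some block to the same index, against injectivity on
    -- `d.2`.
    have h0 := hs.2 ((hev2 (toLex (j, 0))).mono fun d hd => ⟨j, hd, rfl⟩)
    obtain ⟨d, ⟨i, hi, hfi⟩, hd⟩ := (h0.and (hev2 (toLex (j, 1)))).exists
    have := congrArg (fun l => (ofLex l).2) ((hf d).injOn hi hd hfi)
    simp at this

variable {T : L.Theory}

/-- The empty type over `∅` already fails to be dependent, since families of every size defeat its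
bound. -/
theorem AllTypesDependent.not_hasIndependenceProperty {n : ℕ} (h : AllTypesDependent T n) {k : ℕ}
    (φ : L.Formula (Fin n ⊕ Fin k)) : ¬ HasIndependenceProperty T φ := by
  intro hφ
  obtain ⟨M, c, hc⟩ := hφ.exists_infinite
  obtain ⟨μ, hμ⟩ := h M ∅ ∅ (isPartialType_empty ∅ n)
  obtain ⟨N, _, f, a, I, hI, hne⟩ := exists_not_isIndiscernible hc (1 + μ).out
  rw [← Set.image_empty f] at hI
  obtain ⟨j, hj⟩ := hμ N f a (fun φ hφ => hφ.elim) (1 + μ).out (mk_out _) _ I hI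
  exact hne j (hj.mono Set.subset_union_right)

/-- The given bounds may vary with the type, whereas the induction on the length of tuples needs a
uniform one. The detour through the independence property supplies the successor of `max ℵ₀ L.card`.
-/
theorem AllTypesDependent.of_one (h : AllTypesDependent T 1) (n : ℕ) : AllTypesDependent T n := by
  intro M A p _
  have hμ : max ℵ₀ L.card < Order.succ (max ℵ₀ L.card) := Order.lt_succ _
  have hω : ℵ₀ ≤ Order.succ (max ℵ₀ L.card) := (le_max_left _ _).trans hμ.le
  exact ⟨_, ((familyBound_of_not_hasIndependenceProperty
    (fun k φ => h.not_hasIndependenceProperty φ) hμ).of_one hω n).dpRankLE hω M A p⟩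

theorem allTypesDependent_iff (n : ℕ) : AllTypesDependent T n ↔
    ∀ (k : ℕ) (φ : L.Formula (Fin n ⊕ Fin k)), ¬ HasIndependenceProperty T φ := by
  refine ⟨fun h k φ => h.not_hasIndependenceProperty φ, fun h M A p _ => ?_⟩
  have hμ : max ℵ₀ L.card < Order.succ (max ℵ₀ L.card) := Order.lt_succ _
  exact ⟨_, (familyBound_of_not_hasIndependenceProperty h hμ).dpRankLE
    ((le_max_left _ _).trans hμ.le) M A p⟩

theorem dependentTheory_iff_forall : DependentTheory T ↔ ∀ n, AllTypesDependent T n :=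
  forall_congr' fun n => (allTypesDependent_iff n).symm

theorem dependentTheory_iff_one : DependentTheory T ↔ AllTypesDependent T 1 :=
  dependentTheory_iff_forall.trans ⟨fun h => h 1, fun h n => h.of_one n⟩

end

end DpRank

theorem mainTheorem4 {L : FirstOrder.Language.{u, v}} (T : L.Theory) :
    (DpRank.StronglyDependentTheory T ↔ DpRank.AllTypesStronglyDependent T 1) ∧
    (DpRank.DependentTheory T ↔ ∀ n, DpRank.AllTypesDependent T n) ∧
    (DpRank.DependentTheory T ↔ DpRank.AllTypesDependent T 1) ∧
    (DpRank.DependentTheory T ↔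
      ∀ (k : ℕ) (φ : L.Formula (Fin 1 ⊕ Fin k)), ¬ DpRank.HasIndependenceProperty T φ) :=
  ⟨DpRank.stronglyDependentTheory_iff T, DpRank.dependentTheory_iff_forall,
    DpRank.dependentTheory_iff_one,
    DpRank.dependentTheory_iff_one.trans (DpRank.allTypesDependent_iff 1)⟩
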